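/- Let $0<A<B<1$ and let $(\Omega,\mathcal P)$ be a probability space. Let $(a_n,b_n)_{n\ge1}$ be i.i.d. pairs of random variables with $A\le\min(a_n,b_n)$ and $a_n+b_n\le B$, and let $(p_n)_{n\ge 1}$ be i.i.d. random variables with values in $[0,1]$, independent of $(a_n,b_n)_{n\ge1}$, such that $\mathbb E(p_1^{-t})<\infty$ and $\mathbb E((1-p_1)^{-t})<\infty$ for some $t>0$. For $\omega\in\Omega$ construct the Moran intervals as follows: the only interval of step $0$ is $[0,1]$; an interval $I$ of step $n-1$ has two children of step $n$, namely the left-most closed subinterval of $I$ of length $a_n(\omega)|I|$ and the right-most closed subinterval of $I$ of length $b_n(\omega)|I|$. Let $\mu_\omega$ be the Borel probability measure on $[0,1]$ that gives the left child of each interval $I$ of step $n-1$ mass $p_n(\omega)\mu_\omega(I)$ and the right child mass $(1-p_n(\omega))\mu_\omega(I)$. A dimension function is a map $\Phi:(0,1)\to[0,\infty)$ such that $t^{1+\Phi(t)}$ decreases to $0$ as $t$ decreases to $0$. It is large if, for $t$ near $0$, $\Phi(t)=H(t)\,\log|\log t|/|\log t|$ with $H(t)\to\infty$ as $t\to0^+$.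 The upper $\Phi$-dimension $\overline{\dim}_\Phi\mu$ of a measure $\mu$ is the infimum of all real $d$ for which there are constants $C_1\in(0,1)$ and $C_2>0$ such that $$\frac{\mu(B(x,R))}{\mu(B(x,r))}\le C_2\Big(\frac Rr\Big)^d\qquad\text{for all }x\in\operatorname{supp}\mu\text{ and all }0<r<R^{1+\Phi(R)}\le R\le C_1 .$$ For $\theta\ge0$ put $(Y(\theta),Z(\theta))=(\log p_1,\log a_1)$ where $p_1\le \frac{a_1^\theta}{a_1^\theta+b_1^\theta}$, and $(Y(\theta),Z(\theta))=(\log(1-p_1),\log b_1)$ elsewhere, and let $G(\theta)=\mathbb E(Y(\theta))/\mathbb E(Z(\theta))$. Let $\Phi$ be a large dimension function. Then for every real $\alpha$, $\overline{\dim}_\Phi\mu_\omega=\alpha$ almost surely if and only if $G(\psi)<\psi$ for all $\psi\ge 0$ with $\psi>\alpha$, and $G(\psi)\ge\psi$ for all $\psi\ge0$ with $\psi<\alpha$. Moreover, there is always a real $\alpha\ge0$ with these two equivalent properties; that is, $\overline{\dim}_\Phi\mu_\omega$ has a finite almost sure value $\alpha$, and $G$ crosses the diagonal at $\alpha$. 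-/

import Mathlib

open MeasureTheory ProbabilityTheory Filter Topology

/-! ### Dimension functions and the upper `Φ`-dimension of a measure -/

/-- A dimension function: a map `Φ : (0,1) → [0,∞)` such that `t ^ (1 + Φ t)` decreases to `0` as `t`
decreases to `0`. Only the values of `Φ` on `(0,1)` matter. -/
structure IsDimensionFunction (Φ : ℝ → ℝ) : Prop where
  nonneg : ∀ t ∈ Set.Ioo (0 : ℝ) 1, 0 ≤ Φ t
  mono : MonotoneOn (fun t : ℝ => t ^ (1 + Φ t)) (Set.Ioo 0 1)
  tendsto_zero : Tendsto (fun t : ℝ => t ^ (1 + Φ t)) (𝓝[>] 0) (𝓝 0)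

/-- `Φ` is large: `Φ t = H t * log |log t| / |log t|` near `0`, where `H t → ∞` as `t → 0⁺`. -/
def IsLargeDimensionFunction (Φ : ℝ → ℝ) : Prop :=
  IsDimensionFunction Φ ∧
    ∃ H : ℝ → ℝ, Tendsto H (𝓝[>] 0) atTop ∧
      ∀ᶠ t in 𝓝[>] (0 : ℝ), Φ t = H t * (Real.log |Real.log t| / |Real.log t|)

/-- The exponents `d` that are admissible in the definition of the upper `Φ`-dimension of `μ`.
(Requiring `C₁ < 1` only keeps `R` in the domain `(0,1)` of `Φ`; shrinking `C₁` weakens the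
condition.) -/
def upperPhiExponents {X : Type*} [PseudoMetricSpace X] [MeasurableSpace X]
    (Φ : ℝ → ℝ) (μ : Measure X) : Set ℝ :=
  {d : ℝ | ∃ C₁ C₂ : ℝ, 0 < C₁ ∧ C₁ < 1 ∧ 0 < C₂ ∧
    ∀ r R : ℝ, 0 < r → r < R ^ (1 + Φ R) → R ^ (1 + Φ R) ≤ R → 0 < R → R ≤ C₁ →
      ∀ x ∈ μ.support,
        μ (Metric.ball x R) / μ (Metric.ball x r) ≤ ENNReal.ofReal (C₂ * (R / r) ^ d)}

/-- The upper `Φ`-dimension of a measure: the infimum of the admissible exponents, in `[-∞,∞]`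
(the infimum of the empty set is `∞`). -/
noncomputable def upperPhiDim {X : Type*} [PseudoMetricSpace X] [MeasurableSpace X]
    (Φ : ℝ → ℝ) (μ : Measure X) : EReal :=
  ⨅ d ∈ upperPhiExponents Φ μ, (d : EReal)

/-! ### The Moran construction in `[0,1]` with two children per interval

Levels are counted from `0`: `a n`, `b n`, `p n` are used to pass from step `n` to step `n + 1`.
An infinite word `v : ℕ → Bool` records the children chosen: `false` is the left child and `true`
is the right child. -/

/-- The length of the Moran interval of step `n` with label `v 0, …, v (n-1)`. -/
noncomputable def moranLength (a b : ℕ → ℝ) (v : ℕ → Bool) : ℕ → ℝ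
  | 0 => 1
  | n + 1 => (if v n then b n else a n) * moranLength a b v n

/-- The left end point of the Moran interval of step `n` with label `v 0, …, v (n-1)`. The left child
is the outer-most left subinterval, the right child is the outer-most right one. -/
noncomputable def moranLeft (a b : ℕ → ℝ) (v : ℕ → Bool) : ℕ → ℝ
  | 0 => 0
  | n + 1 => moranLeft a b v n + (if v n then (1 - b n) * moranLength a b v n else 0)

/-- The Moran interval of step `n` with label `v 0, …, v (n-1)`. -/
noncomputable def moranInterval (a b : ℕ → ℝ) (v : ℕ → Bool) (n : ℕ) : Set ℝ :=
  Set.Icc (moranLeft a b v n) (moranLeft a b v n + moranLength a b v n)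

/-- The point with address `v`, that is, the point common to all the intervals
`moranInterval a b v n`. -/
noncomputable def moranPoint (a b : ℕ → ℝ) (v : ℕ → Bool) : ℝ :=
  ⨆ n, moranLeft a b v n

/-- The Moran measure: the image, under the coding map `moranPoint a b`, of the product measure on
words under which the `n`-th letter is `false` (left) with probability `p n` and `true` (right) with
probability `1 - p n`. It is the probability measure that gives the left child of a step `n`
interval `I` the mass `p n * μ I` and the right child the mass `(1 - p n) * μ I`; see
`moranMeasure_moranInterval`. -/
noncomputable def moranMeasure (a b : ℕ → ℝ) (p : ℕ → unitInterval) : Measure ℝ :=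
  (Measure.infinitePi fun n => bernoulliMeasure false true (p n)).map (moranPoint a b)

section MoranFacts

variable {a b : ℕ → ℝ}

theorem moranLength_pos (ha : ∀ n, 0 < a n) (hb : ∀ n, 0 < b n) (v : ℕ → Bool) (n : ℕ) :
    0 < moranLength a b v n := by
  induction n with
  | zero => simp [moranLength]
  | succ n ih =>
    rw [moranLength]
    split_ifs
    · exact mul_pos (hb n) ih
    · exact mul_pos (ha n) ih

theorem moranInterval_congr {v w : ℕ → Bool} {n : ℕ} (h : ∀ i < n, v i = w i) :
    moranLength a b v n = moranLength a b w n ∧ moranLeft a b v n = moranLeft a b w n := by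
  induction n with
  | zero => simp [moranLength, moranLeft]
  | succ n ih =>
    obtain ⟨h1, h2⟩ := ih fun i hi => h i (by omega)
    simp only [moranLength, moranLeft, h1, h2, h n (by omega), and_self]

theorem moranInterval_succ_subset (ha : ∀ n, 0 < a n) (hb : ∀ n, 0 < b n)
    (hab : ∀ n, a n + b n < 1) (v : ℕ → Bool) (n : ℕ) :
    moranInterval a b v (n + 1) ⊆ moranInterval a b v n := by
  have hl := moranLength_pos ha hb v n
  have h1 := ha n
  have h2 := hb n
  have h3 := hab n
  apply Set.Icc_subset_Icc
  · simp only [moranLeft]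
    split_ifs
    · nlinarith
    · linarith
  · simp only [moranLeft, moranLength]
    split_ifs
    · nlinarith
    · nlinarith

theorem moranInterval_antitone (ha : ∀ n, 0 < a n) (hb : ∀ n, 0 < b n)
    (hab : ∀ n, a n + b n < 1) (v : ℕ → Bool) : Antitone (moranInterval a b v) :=
  antitone_nat_of_succ_le fun n => moranInterval_succ_subset ha hb hab v n

theorem moranPoint_mem (ha : ∀ n, 0 < a n) (hb : ∀ n, 0 < b n)
    (hab : ∀ n, a n + b n < 1) (v : ℕ → Bool) (n : ℕ) :
    moranPoint a b v ∈ moranInterval a b v n := by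
  have key : ∀ m k, moranLeft a b v m ≤ moranLeft a b v k + moranLength a b v k := by
    intro m k
    have hm : moranLeft a b v (max m k) ∈ moranInterval a b v (max m k) :=
      ⟨le_rfl, by linarith [moranLength_pos ha hb v (max m k)]⟩
    exact (moranInterval_antitone ha hb hab v (le_max_left m k) hm).1.trans
      (moranInterval_antitone ha hb hab v (le_max_right m k) hm).2
  exact ⟨le_ciSup (f := moranLeft a b v) ⟨_, by rintro _ ⟨m, rfl⟩; exact key m 0⟩ n,
    ciSup_le fun m => key m n⟩

theorem moranPoint_mem_iff (ha : ∀ n, 0 < a n) (hb : ∀ n, 0 < b n)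
    (hab : ∀ n, a n + b n < 1) (v w : ℕ → Bool) (n : ℕ) :
    moranPoint a b w ∈ moranInterval a b v n ↔ ∀ i < n, w i = v i := by
  constructor
  · intro h
    induction n with
    | zero => simp
    | succ n ih =>
      have hn := ih (moranInterval_succ_subset ha hb hab v n h)
      obtain ⟨e1, e2⟩ := moranInterval_congr (a := a) (b := b) hn
      have hw := moranPoint_mem ha hb hab w (n + 1)
      have hl := moranLength_pos ha hb v n
      have h3 := hab n
      have hlast : w n = v n := by
        simp only [moranInterval, moranLeft, moranLength, Set.mem_Icc, e1, e2] at h hw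
        cases hwn : w n <;> cases hvn : v n <;> simp [hwn, hvn] at h hw ⊢ <;> nlinarith
      intro i hi
      rcases Nat.lt_succ_iff_lt_or_eq.1 hi with hi | rfl
      · exact hn i hi
      · exact hlast
  · intro h
    obtain ⟨e1, e2⟩ := moranInterval_congr (a := a) (b := b) h
    have hw := moranPoint_mem ha hb hab w n
    rwa [moranInterval, e1, e2] at hw

theorem measurable_moranPoint : Measurable (moranPoint a b) := by
  have hlen : ∀ n, Measurable fun v => moranLength a b v n := by
    intro n
    induction n with
    | zero => simp [moranLength]
    | succ n ih =>
      simp only [moranLength]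
      exact ((measurable_of_countable fun c : Bool => if c then b n else a n).comp
        (measurable_pi_apply n)).mul ih
  have hleft : ∀ n, Measurable fun v => moranLeft a b v n := by
    intro n
    induction n with
    | zero => simp [moranLeft]
    | succ n ih =>
      simp only [moranLeft]
      refine ih.add (Measurable.ite ?_ ((hlen n).const_mul _) measurable_const)
      exact (measurable_pi_apply n : Measurable fun v : ℕ → Bool => v n)
        (measurableSet_singleton true)
  exact Measurable.iSup hleft

instance isProbabilityMeasure_moranMeasure (p : ℕ → unitInterval) :
    IsProbabilityMeasure (moranMeasure a b p) :=
  Measure.isProbabilityMeasure_map measurable_moranPoint.aemeasurable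

/-- The rule that determines the Moran measure. -/
theorem moranMeasure_moranInterval (ha : ∀ n, 0 < a n) (hb : ∀ n, 0 < b n)
    (hab : ∀ n, a n + b n < 1) (p : ℕ → unitInterval) (v : ℕ → Bool) (n : ℕ) :
    moranMeasure a b p (moranInterval a b v n) =
      ∏ i ∈ Finset.range n, ENNReal.ofReal (if v i then 1 - (p i : ℝ) else p i) := by
  rw [moranMeasure, Measure.map_apply measurable_moranPoint (by exact measurableSet_Icc)]
  have hpre : moranPoint a b ⁻¹' moranInterval a b v n =
      Set.pi (Finset.range n : Set ℕ) fun i => {v i} := by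
    ext w
    simp [moranPoint_mem_iff ha hb hab, Set.mem_pi]
  rw [hpre, Measure.infinitePi_pi _ fun i _ => measurableSet_singleton _]
  refine Finset.prod_congr rfl fun i _ => ?_
  have h0 : ENNReal.ofReal (p i : ℝ) = (unitInterval.toNNReal (p i) : ENNReal) :=
    ENNReal.ofReal_eq_coe_nnreal (p i).2.1
  have h1 : ENNReal.ofReal (1 - (p i : ℝ)) =
      (unitInterval.toNNReal (unitInterval.symm (p i)) : ENNReal) :=
    ENNReal.ofReal_eq_coe_nnreal (unitInterval.symm (p i)).2.1
  rw [bernoulliMeasure_def, Measure.add_apply, Measure.coe_nnreal_smul_apply,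
    Measure.coe_nnreal_smul_apply]
  cases v i <;> simp [h0, h1]

end MoranFacts

/-! ### The function `G` -/

/-- The weight `a ^ θ / (a ^ θ + b ^ θ)` against which the probability is compared. -/
noncomputable def moranThreshold (a b θ : ℝ) : ℝ := a ^ θ / (a ^ θ + b ^ θ)

/-- `Y(θ)` as a function of the values of `a`, `b`, `p`. -/
noncomputable def moranY (a b p θ : ℝ) : ℝ :=
  if p ≤ moranThreshold a b θ then Real.log p else Real.log (1 - p)

/-- `Z(θ)` as a function of the values of `a`, `b`, `p`. -/
noncomputable def moranZ (a b p θ : ℝ) : ℝ :=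
  if p ≤ moranThreshold a b θ then Real.log a else Real.log b

/-- `G(θ) = 𝔼 Y(θ) / 𝔼 Z(θ)`, for the random variables `a`, `b`, `p` of the first step. -/
noncomputable def moranG {Ω : Type*} [MeasurableSpace Ω] (P : Measure Ω)
    (a b : Ω → ℝ) (p : Ω → unitInterval) (θ : ℝ) : ℝ :=
  (∫ ω, moranY (a ω) (b ω) (p ω) θ ∂P) / (∫ ω, moranZ (a ω) (b ω) (p ω) θ ∂P)

/-- `G` crosses the diagonal at `α`: `G ψ < ψ` for all `ψ > α` and `G ψ ≥ ψ` for all `ψ < α`, where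
`ψ` ranges over the domain `[0,∞)` of `G`. -/
def CrossesDiagonalAt (G : ℝ → ℝ) (α : ℝ) : Prop :=
  (∀ ψ : ℝ, 0 ≤ ψ → α < ψ → G ψ < ψ) ∧ (∀ ψ : ℝ, 0 ≤ ψ → ψ < α → ψ ≤ G ψ)

/-! Write $X_n(\theta)$ for $Y-\theta Z$ at step $n$. Of the two children it takes the smaller value
of log(mass ratio) $-\,\theta$ log(length ratio). So the sum of $X_i(\theta)$ over $m\le i<n$ is the
least value, over all words, of $\log(\mu(I_n)/\mu(I_m))-\theta\log(|I_n|/|I_m|)$. The gaps make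
balls comparable to intervals, and $d\ge 0$ is admissible, up to constants, when these block sums of
$X_i(d)$ stay bounded below over the blocks that $\Phi$ allows.

The mean $F(\theta)=\mathbb E X(\theta)$ is continuous and strictly increasing with $F(0)\le 0$, and
it has a zero $\alpha\ge 0$. As $F(\theta)=\mathbb E Y-\theta\,\mathbb E Z$ with $\mathbb E Z<0$,
the sign of $F$ tells on which side of the diagonal $G$ lies.

If $d<\alpha$, the partial sums tend to $-\infty$ by the strong law, and the word that always takes
the minimizing child violates the bound (`notMem_upperPhiExponents`). If $d>\alpha$, a Chernoff
bound makes a block of length $k$ have sum $\le 0$ with probability at most $\rho^k$, $\rho<1$.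
Largeness of $\Phi$ leaves only blocks starting at some $m\le L^k$ with $L>1$ as close to $1$ as
desired (`exists_scale`), so a union bound and Borel–Cantelli apply
(`exists_ae_eventually_sum_nonneg`, `mem_upperPhiExponents`). Admissibility is monotone in $d$, so
rational $d$ suffice. -/

/-! ### Geometry of the Moran intervals -/

/-- The ratios of the construction are bounded below by `A > 0`, and the gaps by `1 - B > 0`. -/
structure IsMoranBounded (A B : ℝ) (a b : ℕ → ℝ) : Prop where
  pos : 0 < A
  lt_one : B < 1
  left : ∀ n, A ≤ a n
  right : ∀ n, A ≤ b n
  add_le : ∀ n, a n + b n ≤ B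

/-- The mass of the Moran interval of step `n` with label `v 0, …, v (n-1)`. -/
noncomputable def moranMass (p : ℕ → unitInterval) (v : ℕ → Bool) (n : ℕ) : ℝ :=
  ∏ i ∈ Finset.range n, (if v i then 1 - (p i : ℝ) else p i)

/-- The random variable `Y(θ) - θ Z(θ)`, the smaller one of `log p - θ log a` and
`log (1 - p) - θ log b`. -/
noncomputable def moranX (θ : ℝ) (x : ℝ × ℝ × unitInterval) : ℝ :=
  moranY x.1 x.2.1 x.2.2 θ - θ * moranZ x.1 x.2.1 x.2.2 θ

/-- Both sides are forms of $p\,b^\theta\le(1-p)\,a^\theta$. This is why the threshold in $Y$ and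
$Z$ selects a minimum. -/
theorem le_moranThreshold_iff {a b p : ℝ} (ha : 0 < a) (hb : 0 < b) (hp : 0 < p) (hp1 : p < 1)
    (θ : ℝ) :
    p ≤ moranThreshold a b θ ↔
      Real.log p - θ * Real.log a ≤ Real.log (1 - p) - θ * Real.log b := by
  have ha' := Real.rpow_pos_of_pos ha θ
  have hb' := Real.rpow_pos_of_pos hb θ
  have h1 : 0 < 1 - p := by linarith
  rw [moranThreshold, le_div_iff₀ (by positivity)]
  have e : p * (a ^ θ + b ^ θ) ≤ a ^ θ ↔ p * b ^ θ ≤ (1 - p) * a ^ θ := by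
    constructor <;> intro h <;> nlinarith
  rw [e, ← Real.log_le_log_iff (by positivity) (by positivity),
    Real.log_mul hp.ne' hb'.ne', Real.log_mul h1.ne' ha'.ne', Real.log_rpow ha, Real.log_rpow hb]
  constructor <;> intro h <;> linarith

theorem moranX_eq_min {x : ℝ × ℝ × unitInterval} (ha : 0 < x.1) (hb : 0 < x.2.1)
    (hp : 0 < (x.2.2 : ℝ)) (hp1 : (x.2.2 : ℝ) < 1) (θ : ℝ) :
    moranX θ x = min (Real.log x.2.2 - θ * Real.log x.1)
      (Real.log (1 - x.2.2) - θ * Real.log x.2.1) := by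
  have h := le_moranThreshold_iff ha hb hp hp1 θ
  unfold moranX moranY moranZ
  split_ifs with hc
  · rw [min_eq_left (h.1 hc)]
  · rw [min_eq_right]
    exact (not_le.1 fun h' => hc (h.2 h')).le

namespace IsMoranBounded

variable {A B : ℝ} {a b : ℕ → ℝ} (h : IsMoranBounded A B a b)
include h

theorem left_pos (n : ℕ) : 0 < a n := h.pos.trans_le (h.left n)

theorem right_pos (n : ℕ) : 0 < b n := h.pos.trans_le (h.right n)

theorem add_lt_one (n : ℕ) : a n + b n < 1 := (h.add_le n).trans_lt h.lt_one

theorem left_le (n : ℕ) : a n ≤ B := by linarith [h.add_le n, h.right_pos n]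

theorem right_le (n : ℕ) : b n ≤ B := by linarith [h.add_le n, h.left_pos n]

theorem bound_pos : 0 < B := (h.left_pos 0).trans_le (h.left_le 0)

theorem lower_lt_one : A < 1 := ((h.left 0).trans (h.left_le 0)).trans_lt h.lt_one

theorem length_pos (v : ℕ → Bool) (n : ℕ) : 0 < moranLength a b v n :=
  moranLength_pos h.left_pos h.right_pos v n

theorem ratio_mem (v : ℕ → Bool) (n : ℕ) :
    A ≤ (if v n then b n else a n) ∧ (if v n then b n else a n) ≤ B := by
  split_ifs
  exacts [⟨h.right n, h.right_le n⟩, ⟨h.left n, h.left_le n⟩]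

theorem mul_length_le (v : ℕ → Bool) (n : ℕ) :
    A * moranLength a b v n ≤ moranLength a b v (n + 1) :=
  mul_le_mul_of_nonneg_right (h.ratio_mem v n).1 (h.length_pos v n).le

theorem length_succ_le (v : ℕ → Bool) (n : ℕ) :
    moranLength a b v (n + 1) ≤ B * moranLength a b v n :=
  mul_le_mul_of_nonneg_right (h.ratio_mem v n).2 (h.length_pos v n).le

theorem length_antitone (v : ℕ → Bool) : Antitone (moranLength a b v) :=
  antitone_nat_of_succ_le fun n => (h.length_succ_le v n).trans
    (mul_le_of_le_one_left (h.length_pos v n).le h.lt_one.le)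

theorem length_le_pow (v : ℕ → Bool) (n : ℕ) : moranLength a b v n ≤ B ^ n := by
  induction n with
  | zero => simp [moranLength]
  | succ n ih =>
    rw [pow_succ']
    exact (h.length_succ_le v n).trans (mul_le_mul_of_nonneg_left ih h.bound_pos.le)

theorem pow_mul_length_le (v : ℕ → Bool) (m k : ℕ) :
    A ^ k * moranLength a b v m ≤ moranLength a b v (m + k) := by
  induction k with
  | zero => simp
  | succ k ih =>
    rw [pow_succ', mul_assoc, ← add_assoc]
    exact (mul_le_mul_of_nonneg_left ih h.pos.le).trans (h.mul_length_le v (m + k))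

theorem tendsto_length (v : ℕ → Bool) : Tendsto (moranLength a b v) atTop (𝓝 0) :=
  squeeze_zero (fun n => (h.length_pos v n).le) (h.length_le_pow v)
    (tendsto_pow_atTop_nhds_zero_of_lt_one h.bound_pos.le h.lt_one)

theorem log_length (v : ℕ → Bool) (n : ℕ) : Real.log (moranLength a b v n) =
    ∑ i ∈ Finset.range n, Real.log (if v i then b i else a i) := by
  induction n with
  | zero => simp [moranLength]
  | succ n ih =>
    rw [moranLength, Finset.sum_range_succ, ← ih, Real.log_mul _ (h.length_pos v n).ne', add_comm]
    exact (h.pos.trans_le (h.ratio_mem v n).1).ne'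

theorem point_mem (v : ℕ → Bool) (n : ℕ) : moranPoint a b v ∈ moranInterval a b v n :=
  moranPoint_mem h.left_pos h.right_pos h.add_lt_one v n

theorem dist_le_of_agree {v w : ℕ → Bool} {n : ℕ} (hvw : ∀ i < n, w i = v i) :
    |moranPoint a b w - moranPoint a b v| ≤ moranLength a b v n := by
  have h1 := h.point_mem v n
  have h2 := (moranPoint_mem_iff h.left_pos h.right_pos h.add_lt_one v w n).2 hvw
  simp only [moranInterval, Set.mem_Icc] at h1 h2
  rw [abs_le]
  constructor <;> linarith

/-- Two siblings inside $I$ are separated by $|I|-a_n|I|-b_n|I|\ge(1-B)|I|$. -/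
theorem gap_le_of_ne {v w : ℕ → Bool} {n : ℕ} (hvw : ∀ i < n, w i = v i) (hn : w n ≠ v n) :
    (1 - B) * moranLength a b v n ≤ |moranPoint a b w - moranPoint a b v| := by
  have h1 := h.point_mem v (n + 1)
  have h2 := h.point_mem w (n + 1)
  obtain ⟨e1, e2⟩ := moranInterval_congr (a := a) (b := b) hvw
  have hl := h.length_pos v n
  have hadd := h.add_le n
  simp only [moranInterval, moranLeft, moranLength, Set.mem_Icc, e1, e2] at h1 h2
  rw [le_abs]
  cases hwn : w n <;> cases hvn : v n <;> simp [hwn, hvn] at h1 h2 hn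
  · right; nlinarith
  · left; nlinarith

/-- Points at distance less than the gap of the interval of step `n` share the first `n + 1`
letters. -/
theorem agree_of_lt {v w : ℕ → Bool} {n : ℕ}
    (hlt : |moranPoint a b w - moranPoint a b v| < (1 - B) * moranLength a b v n) :
    ∀ i < n + 1, w i = v i := by
  intro i
  induction i using Nat.strong_induction_on with
  | _ i ih =>
    intro hi
    by_contra hne
    -- A first disagreement at `i ≤ n` would force a distance of at least the gap at step `i`, which
    -- is no smaller than `(1 - B) * moranLength a b v n`.
    have h1 := h.gap_le_of_ne (fun j hj => ih j hj (by omega)) hne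
    have h2 := h.length_antitone v (show i ≤ n by omega)
    have h3 : 0 < 1 - B := by linarith [h.lt_one]
    nlinarith

theorem continuous_point : Continuous (moranPoint a b) := by
  rw [continuous_iff_continuousAt]
  intro v
  rw [Metric.continuousAt_iff']
  intro ε hε
  obtain ⟨n, hn⟩ := ((h.tendsto_length v).eventually_lt_const hε).exists
  have : ∀ᶠ w in 𝓝 v, ∀ i ∈ Finset.range n, w i = v i := by
    rw [Finset.eventually_all]
    intro i _
    exact (continuous_apply i).continuousAt.eventually_mem
      ((isOpen_discrete {v i}).mem_nhds rfl)
  filter_upwards [this] with w hw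
  exact (h.dist_le_of_agree fun i hi => hw i (Finset.mem_range.2 hi)).trans_lt hn

/-- The set of coded points is compact, as a continuous image of the Cantor space, and has full
measure. Hence every point of the support has an address. -/
theorem support_subset (p : ℕ → unitInterval) :
    (moranMeasure a b p).support ⊆ Set.range (moranPoint a b) := by
  have hc : IsClosed (Set.range (moranPoint a b)) :=
    (isCompact_range h.continuous_point).isClosed
  refine Measure.support_subset_of_isClosed hc ?_
  rw [mem_ae_iff, moranMeasure, Measure.map_apply measurable_moranPoint hc.measurableSet.compl]
  simp [Set.preimage_compl, Set.preimage_range]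

theorem measure_interval {p : ℕ → unitInterval} (v : ℕ → Bool) (n : ℕ) :
    moranMeasure a b p (moranInterval a b v n) = ENNReal.ofReal (moranMass p v n) := by
  rw [moranMeasure_moranInterval h.left_pos h.right_pos h.add_lt_one, moranMass,
    ENNReal.ofReal_prod_of_nonneg]
  intro i _
  split_ifs
  · linarith [(p i).2.2]
  · exact (p i).2.1

/-- A radius below the gap of the parent keeps the ball, up to a null set, inside one interval of
step `n`; at step `0` that interval carries the whole measure. -/
theorem measure_ball_le {p : ℕ → unitInterval} {v : ℕ → Bool} {n : ℕ} {R : ℝ}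
    (hR : n = 0 ∨ R ≤ (1 - B) * moranLength a b v (n - 1)) :
    moranMeasure a b p (Metric.ball (moranPoint a b v) R) ≤ ENNReal.ofReal (moranMass p v n) := by
  rw [← h.measure_interval v n, moranMeasure,
    Measure.map_apply measurable_moranPoint measurableSet_ball,
    Measure.map_apply measurable_moranPoint (by exact measurableSet_Icc)]
  refine measure_mono fun w hw => ?_
  rw [Set.mem_preimage, moranPoint_mem_iff h.left_pos h.right_pos h.add_lt_one]
  rcases hR with rfl | hR
  · simp
  · intro i hi
    exact h.agree_of_lt (lt_of_lt_of_le hw hR) i (by omega)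

theorem le_measure_ball {p : ℕ → unitInterval} {v : ℕ → Bool} {n : ℕ} {r : ℝ}
    (hr : moranLength a b v n < r) :
    ENNReal.ofReal (moranMass p v n) ≤ moranMeasure a b p (Metric.ball (moranPoint a b v) r) := by
  rw [← h.measure_interval v n]
  refine measure_mono fun y hy => ?_
  have h1 := h.point_mem v n
  simp only [moranInterval, Set.mem_Icc] at h1 hy
  rw [Metric.mem_ball, Real.dist_eq, abs_lt]
  constructor <;> linarith

end IsMoranBounded

theorem moranMass_pos {p : ℕ → unitInterval} (hp : ∀ n, 0 < (p n : ℝ)) (hp1 : ∀ n, (p n : ℝ) < 1)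
    (v : ℕ → Bool) (n : ℕ) : 0 < moranMass p v n := by
  refine Finset.prod_pos fun i _ => ?_
  split_ifs
  · linarith [hp1 i]
  · exact hp i

theorem log_moranMass {p : ℕ → unitInterval} (hp : ∀ n, 0 < (p n : ℝ))
    (hp1 : ∀ n, (p n : ℝ) < 1) (v : ℕ → Bool) (n : ℕ) : Real.log (moranMass p v n) =
      ∑ i ∈ Finset.range n, Real.log (if v i then 1 - (p i : ℝ) else p i) := by
  refine Real.log_prod fun i _ => ?_
  split_ifs
  · linarith [hp1 i]
  · exact (hp i).ne'

namespace IsMoranBounded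

variable {A B : ℝ} {a b : ℕ → ℝ} (h : IsMoranBounded A B a b)
include h

theorem mem_support {p : ℕ → unitInterval} (hp : ∀ n, 0 < (p n : ℝ))
    (hp1 : ∀ n, (p n : ℝ) < 1) (v : ℕ → Bool) :
    moranPoint a b v ∈ (moranMeasure a b p).support := by
  rw [Measure.mem_support_iff_forall]
  intro U hU
  obtain ⟨ε, hε, hsub⟩ := Metric.mem_nhds_iff.1 hU
  obtain ⟨n, hn⟩ := ((h.tendsto_length v).eventually_lt_const hε).exists
  exact (ENNReal.ofReal_pos.2 (moranMass_pos hp hp1 v n)).trans_le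
    ((h.le_measure_ball hn).trans (measure_mono hsub))

theorem moranX_le {p : ℕ → unitInterval} (hp : ∀ n, 0 < (p n : ℝ))
    (hp1 : ∀ n, (p n : ℝ) < 1) (θ : ℝ) (v : ℕ → Bool) (i : ℕ) :
    moranX θ (a i, b i, p i) ≤ Real.log (if v i then 1 - (p i : ℝ) else p i) -
      θ * Real.log (if v i then b i else a i) := by
  rw [moranX_eq_min (h.left_pos i) (h.right_pos i) (hp i) (hp1 i)]
  split_ifs
  exacts [min_le_right _ _, min_le_left _ _]

/-- The lower bound does not depend on `v` beyond the two steps, so it controls all points of the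
support at once. -/
theorem sum_moranX_le {p : ℕ → unitInterval} (hp : ∀ n, 0 < (p n : ℝ))
    (hp1 : ∀ n, (p n : ℝ) < 1) (θ : ℝ) (v : ℕ → Bool) {m n : ℕ} (hmn : m ≤ n) :
    ∑ i ∈ Finset.Ico m n, moranX θ (a i, b i, p i) ≤
      (Real.log (moranMass p v n) - Real.log (moranMass p v m)) -
        θ * (Real.log (moranLength a b v n) - Real.log (moranLength a b v m)) := by
  rw [log_moranMass hp hp1, log_moranMass hp hp1, h.log_length, h.log_length,
    ← Finset.sum_Ico_eq_sub _ hmn, ← Finset.sum_Ico_eq_sub _ hmn, Finset.mul_sum,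
    ← Finset.sum_sub_distrib]
  exact Finset.sum_le_sum fun i _ => h.moranX_le hp hp1 θ v i

end IsMoranBounded

/-! ### Admissible exponents of the Moran measure -/

/-- For a large dimension function, the pairs of scales `r < R ^ (1 + Φ R)` lie many steps of the
construction apart, at least logarithmically many in terms of the step that corresponds to `R`. -/
theorem IsLargeDimensionFunction.exists_scale {Φ : ℝ → ℝ} (hΦ : IsLargeDimensionFunction Φ)
    {A B L : ℝ} (hA : 0 < A) (hA1 : A < 1) (hB : 0 < B) (hB1 : B < 1) (hL : 1 < L) (k₀ : ℕ) :
    ∃ C : ℝ, 0 < C ∧ C < 1 ∧ ∀ r R : ℝ, 0 < r → r < R ^ (1 + Φ R) → 0 < R → R ≤ C →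
      ∀ m k : ℕ, A * R ≤ B ^ m → A ^ k * (A * R) ≤ r → k₀ ≤ k ∧ (m : ℝ) ≤ L ^ k := by
  obtain ⟨-, H, hH, hΦH⟩ := hΦ
  set cA := -Real.log A with hcA
  set cB := -Real.log B with hcB
  have hcA0 : 0 < cA := by have := Real.log_neg hA hA1; linarith
  have hcB0 : 0 < cB := by have := Real.log_neg hB hB1; linarith
  have hL0 := Real.log_pos hL
  have hu : Tendsto (fun R : ℝ => -Real.log R) (𝓝[>] 0) atTop :=
    tendsto_neg_atBot_atTop.comp Real.tendsto_log_nhdsGT_zero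
  -- With $u=-\log R$, the bounds on `H` give $k_0\le k$ and $u^2\le L^k$ respectively; $u\ge e$
  -- ensures $\log u\ge1$, and the last two bounds give $m\le u^2$.
  have hev : ∀ᶠ R in 𝓝[>] (0 : ℝ), Φ R = H R * (Real.log |Real.log R| / |Real.log R|) ∧
      cA * (k₀ + 1) ≤ H R ∧ cA * (2 / Real.log L + 1) ≤ H R ∧ Real.exp 1 ≤ -Real.log R ∧
      cA ≤ -Real.log R ∧ 2 / cB ≤ -Real.log R := by
    filter_upwards [hΦH, hH.eventually_ge_atTop _, hH.eventually_ge_atTop _,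
      hu.eventually_ge_atTop _, hu.eventually_ge_atTop _, hu.eventually_ge_atTop _]
      with R h1 h2 h3 h4 h5 h6 using ⟨h1, h2, h3, h4, h5, h6⟩
  obtain ⟨ε, hε, hsub⟩ := mem_nhdsGT_iff_exists_Ioo_subset.1 hev
  have hε0 : 0 < ε := hε
  refine ⟨min ε 1 / 2, by positivity, by linarith [min_le_right ε 1], ?_⟩
  intro r R hr hrR hR hRC m k hm hk
  obtain ⟨h1, h2, h3, h4, h5, h6⟩ := hsub (show R ∈ Set.Ioo 0 ε from
    ⟨hR, by have := min_le_left ε 1; have : 0 < min ε 1 := by positivity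
            linarith⟩)
  set u := -Real.log R with hu'
  have hu0 : 0 < u := (Real.exp_pos 1).trans_le h4
  have habs : |Real.log R| = u := by rw [hu', abs_of_neg (by linarith)]
  have hlogu : 1 ≤ Real.log u := by rwa [Real.le_log_iff_exp_le hu0]
  rw [habs] at h1
  have hΦu : Φ R * u = H R * Real.log u := by rw [h1]; field_simp
  have hk1 : H R * Real.log u ≤ (k + 1) * cA := by
    have e1 := Real.log_lt_log hr hrR
    rw [Real.log_rpow hR] at e1
    have e2 := Real.log_le_log (by positivity) hk
    rw [Real.log_mul (by positivity) (by positivity), Real.log_mul hA.ne' hR.ne', Real.log_pow] at e2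
    have : (1 + Φ R) * Real.log R = -u - Φ R * u := by rw [hu']; ring
    nlinarith
  have hm1 : m * cB ≤ u + cA := by
    have e := Real.log_le_log (by positivity) hm
    rw [Real.log_mul hA.ne' hR.ne', Real.log_pow] at e
    linarith
  have hHn : 0 ≤ H R := le_trans (by positivity) h2
  have hk2 : H R ≤ (k + 1) * cA := (le_mul_of_one_le_right hHn hlogu).trans hk1
  constructor
  · have : ((k₀ : ℝ) + 1) ≤ k + 1 := by
      refine le_of_mul_le_mul_right ?_ hcA0
      linarith
    exact_mod_cast (by linarith : (k₀ : ℝ) ≤ k)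
  · have hkL : 2 * Real.log u ≤ k * Real.log L := by
      have e1 : cA * (2 / Real.log L + 1) * Real.log u ≤ (k + 1) * cA :=
        (mul_le_mul_of_nonneg_right h3 (by linarith)).trans hk1
      have e2 : (2 / Real.log L + 1) * Real.log u ≤ k + 1 := by
        refine le_of_mul_le_mul_right ?_ hcA0
        linarith
      have e3 : 2 / Real.log L * Real.log u ≤ k := by nlinarith
      calc 2 * Real.log u = 2 / Real.log L * Real.log u * Real.log L := by field_simp
        _ ≤ k * Real.log L := mul_le_mul_of_nonneg_right e3 hL0.le
    have hm2 : (m : ℝ) ≤ u ^ 2 := by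
      have : (m : ℝ) ≤ u * (2 / cB) := by
        rw [mul_div_assoc', le_div_iff₀ hcB0]
        linarith
      nlinarith
    refine hm2.trans ((Real.log_le_log_iff (by positivity) (by positivity)).1 ?_)
    rw [Real.log_pow, Real.log_pow]
    exact_mod_cast hkL

namespace IsMoranBounded

variable {A B : ℝ} {a b : ℕ → ℝ} (h : IsMoranBounded A B a b)
include h

/-- The first step at which the intervals around the point with address `v` are shorter than `s`. -/
theorem exists_step {s : ℝ} (hs : 0 < s) (v : ℕ → Bool) :
    ∃ n, moranLength a b v n < s ∧ (∀ k, moranLength a b v k < s → n ≤ k) ∧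
      (n = 0 ∨ s ≤ moranLength a b v (n - 1)) := by
  classical
  have hex := ((h.tendsto_length v).eventually_lt_const hs).exists
  refine ⟨Nat.find hex, Nat.find_spec hex, fun k hk => Nat.find_min' hex hk, ?_⟩
  rcases Nat.eq_zero_or_pos (Nat.find hex) with h0 | h0
  · exact Or.inl h0
  · exact Or.inr (not_lt.1 (Nat.find_min hex (by omega)))

/-- The parent still has length at least `s`, and one step shrinks by a factor of at least `A`; `s ≤
1` covers step `0`. -/
theorem mul_le_length {s : ℝ} {v : ℕ → Bool} {n : ℕ} (hs : s ≤ 1)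
    (hn : n = 0 ∨ s ≤ moranLength a b v (n - 1)) : A * s ≤ moranLength a b v n := by
  have hA := h.pos
  have hA1 := h.lower_lt_one
  rcases hn with rfl | hn
  · rw [moranLength]
    nlinarith
  · rcases Nat.eq_zero_or_pos n with rfl | h0
    · rw [moranLength]
      nlinarith
    · have := h.mul_length_le v (n - 1)
      rw [Nat.sub_add_cancel h0] at this
      nlinarith

theorem mem_upperPhiExponents {p : ℕ → unitInterval} (hp : ∀ n, 0 < (p n : ℝ))
    (hp1 : ∀ n, (p n : ℝ) < 1) {Φ : ℝ → ℝ} (hΦ : IsLargeDimensionFunction Φ) {d L : ℝ}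
    (hd : 0 ≤ d) (hL : 1 < L)
    (hsum : ∀ᶠ k : ℕ in atTop, ∀ m : ℕ, (m : ℝ) ≤ L ^ k →
      0 ≤ ∑ i ∈ Finset.Ico m (m + k), moranX d (a i, b i, p i)) :
    d ∈ upperPhiExponents Φ (moranMeasure a b p) := by
  obtain ⟨k₀, hk₀⟩ := eventually_atTop.1 hsum
  obtain ⟨C, hC0, hC1, hC⟩ :=
    hΦ.exists_scale h.pos h.lower_lt_one h.bound_pos h.lt_one hL k₀
  have hA := h.pos
  have hgap : 0 < 1 - B := by linarith [h.lt_one]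
  have hB0 := h.bound_pos
  refine ⟨C, (1 / ((1 - B) * A)) ^ d, hC0, hC1, by positivity, ?_⟩
  intro r R hr hrR hRR hR hRC x hx
  obtain ⟨v, rfl⟩ := h.support_subset p hx
  have hR1 : R ≤ 1 := by linarith
  have hr1 : r ≤ R := hrR.le.trans hRR
  -- At scale `R / (1 - B)` the parent, if there is one, has a gap of at least `R`, so the large
  -- ball has at most the mass of the interval of step `m`. The interval of step `n` fits in the
  -- small ball.
  obtain ⟨m, hm1, hm2, hm3⟩ := h.exists_step (s := R / (1 - B)) (by positivity) v
  obtain ⟨n, hn1, -, hn3⟩ := h.exists_step hr v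
  have hRg : R ≤ R / (1 - B) := by
    rw [le_div_iff₀ hgap]
    nlinarith
  have hmn : m ≤ n := hm2 n (by linarith)
  have hAm : A * R ≤ moranLength a b v m :=
    h.mul_le_length hR1 (hm3.imp id fun h' => hRg.trans h')
  have hAn : A * r ≤ moranLength a b v n := h.mul_le_length (hr1.trans hR1) hn3
  have hpow := h.pow_mul_length_le v m (n - m)
  rw [Nat.add_sub_cancel' hmn] at hpow
  have hkm := hC r R hr hrR hR hRC m (n - m) (hAm.trans (h.length_le_pow v m)) (by
    have : A ^ (n - m) * (A * R) ≤ A ^ (n - m) * moranLength a b v m :=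
      mul_le_mul_of_nonneg_left hAm (by positivity)
    linarith)
  have hs := hk₀ _ hkm.1 m hkm.2
  rw [Nat.add_sub_cancel' hmn] at hs
  have hle := hs.trans (h.sum_moranX_le hp hp1 d v hmn)
  have hWm := moranMass_pos hp hp1 v m
  have hWn := moranMass_pos hp hp1 v n
  have hball : moranMeasure a b p (Metric.ball (moranPoint a b v) R) ≤
      ENNReal.ofReal (moranMass p v m) := by
    refine h.measure_ball_le (hm3.imp id fun h' => ?_)
    rw [div_le_iff₀ hgap] at h'
    linarith
  refine (ENNReal.div_le_div hball (h.le_measure_ball hn1)).trans ?_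
  rw [← ENNReal.ofReal_div_of_pos hWn]
  refine ENNReal.ofReal_le_ofReal ?_
  rw [← Real.mul_rpow (by positivity) (by positivity),
    ← Real.log_le_log_iff (by positivity) (by positivity), Real.log_rpow (by positivity),
    Real.log_div hWm.ne' hWn.ne']
  -- Both lengths match their radii up to the factors `1 / (1 - B)` and `A`, whence the constant
  -- `C₂`.
  have hlen : Real.log (moranLength a b v m) - Real.log (moranLength a b v n) ≤
      Real.log (1 / ((1 - B) * A) * (R / r)) := by
    rw [← Real.log_div (h.length_pos v m).ne' (h.length_pos v n).ne']
    refine Real.log_le_log (div_pos (h.length_pos v m) (h.length_pos v n)) ?_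
    calc moranLength a b v m / moranLength a b v n ≤ (R / (1 - B)) / (A * r) :=
          div_le_div₀ (by positivity) hm1.le (by positivity) hAn
      _ = 1 / ((1 - B) * A) * (R / r) := by field_simp
  have := mul_le_mul_of_nonneg_left hlen hd
  linarith

theorem notMem_upperPhiExponents {p : ℕ → unitInterval} (hp : ∀ n, 0 < (p n : ℝ))
    (hp1 : ∀ n, (p n : ℝ) < 1) {Φ : ℝ → ℝ} (hΦ : IsDimensionFunction Φ) {d : ℝ}
    (hsum : Tendsto (fun n : ℕ => ∑ i ∈ Finset.range n, moranX d (a i, b i, p i)) atTop atBot) :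
    d ∉ upperPhiExponents Φ (moranMeasure a b p) := by
  -- The outer radius stays fixed at the largest allowed value `C₁`; only the inner radius tends to
  -- `0`.
  rintro ⟨R, C, hR, hR1, hC, hbound⟩
  have hgap : 0 < 1 - B := by linarith [h.lt_one]
  -- The minimizing word: the right child is taken exactly above the threshold, which turns
  -- `sum_moranX_le` into an equality.
  let v : ℕ → Bool := fun i => !decide ((p i : ℝ) ≤ moranThreshold (a i) (b i) d)
  have hX : ∀ n, ∑ i ∈ Finset.range n, moranX d (a i, b i, p i) =
      Real.log (moranMass p v n) - d * Real.log (moranLength a b v n) := by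
    intro n
    rw [log_moranMass hp hp1, h.log_length, Finset.mul_sum, ← Finset.sum_sub_distrib]
    refine Finset.sum_congr rfl fun i _ => ?_
    by_cases hi : (p i : ℝ) ≤ moranThreshold (a i) (b i) d <;>
      simp [v, moranX, moranY, moranZ, hi]
  have hsupp := h.mem_support hp hp1 v
  set M := moranMeasure a b p (Metric.ball (moranPoint a b v) R) with hM
  have hM0 : 0 < M := (Measure.mem_support_iff_forall _).1 hsupp _ (Metric.ball_mem_nhds _ hR)
  have hMtop : M ≠ ⊤ := measure_ne_top _ _
  have hMr : 0 < M.toReal := ENNReal.toReal_pos hM0.ne' hMtop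
  have hev : ∀ᶠ n : ℕ in atTop, (1 - B) * moranLength a b v n < R ^ (1 + Φ R) := by
    have := (h.tendsto_length v).const_mul (1 - B)
    rw [mul_zero] at this
    exact this.eventually_lt_const (by positivity)
  obtain ⟨n, hn1, hn2⟩ := (hev.and (hsum.eventually_lt_atBot
    (Real.log M.toReal - Real.log C - d * Real.log (R / (1 - B))))).exists
  rw [hX n] at hn2
  have hl := h.length_pos v n
  have hW := moranMass_pos hp hp1 v n
  have hRR : R ^ (1 + Φ R) ≤ R := by
    have := Real.rpow_le_rpow_of_exponent_ge hR hR1.le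
      (show (1 : ℝ) ≤ 1 + Φ R by linarith [hΦ.nonneg R ⟨hR, hR1⟩])
    rwa [Real.rpow_one] at this
  have hb := hbound ((1 - B) * moranLength a b v n) R (by positivity) hn1 hRR hR le_rfl _ hsupp
  have hball : moranMeasure a b p (Metric.ball (moranPoint a b v) ((1 - B) * moranLength a b v n)) ≤
      ENNReal.ofReal (moranMass p v n) :=
    h.measure_ball_le (Or.inr (mul_le_mul_of_nonneg_left
      (h.length_antitone v (Nat.sub_le n 1)) hgap.le))
  have hdiv := (ENNReal.div_le_div le_rfl hball).trans hb
  rw [← hM, ← ENNReal.ofReal_toReal hMtop, ← ENNReal.ofReal_div_of_pos hW,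
    ENNReal.ofReal_le_ofReal_iff (by positivity)] at hdiv
  have hlog := Real.log_le_log (by positivity) hdiv
  rw [Real.log_div hMr.ne' hW.ne', Real.log_mul hC.ne' (by positivity),
    Real.log_rpow (by positivity), ← div_div, Real.log_div (by positivity) hl.ne'] at hlog
  linarith

end IsMoranBounded

theorem upperPhiExponents_mono {X : Type*} [PseudoMetricSpace X] [MeasurableSpace X] {Φ : ℝ → ℝ}
    {μ : Measure X} {d e : ℝ} (hd : d ∈ upperPhiExponents Φ μ) (hde : d ≤ e) :
    e ∈ upperPhiExponents Φ μ := by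
  obtain ⟨C₁, C₂, h1, h2, h3, h4⟩ := hd
  refine ⟨C₁, C₂, h1, h2, h3, fun r R hr hrR hRR hR hRC x hx => ?_⟩
  refine (h4 r R hr hrR hRR hR hRC x hx).trans (ENNReal.ofReal_le_ofReal ?_)
  refine mul_le_mul_of_nonneg_left (Real.rpow_le_rpow_of_exponent_le ?_ hde) h3.le
  rw [le_div_iff₀ hr]
  linarith

/-- Testing countably many exponents allows the exceptional null sets to be united. -/
theorem upperPhiDim_eq_of_forall_rat {X : Type*} [PseudoMetricSpace X] [MeasurableSpace X]
    {Φ : ℝ → ℝ} {μ : Measure X} {α : ℝ}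
    (hlt : ∀ q : ℚ, (q : ℝ) < α → (q : ℝ) ∉ upperPhiExponents Φ μ)
    (hgt : ∀ q : ℚ, α < (q : ℝ) → (q : ℝ) ∈ upperPhiExponents Φ μ) :
    upperPhiDim Φ μ = (α : EReal) := by
  refine le_antisymm ?_ ?_
  · refine EReal.le_of_forall_lt_iff_le.1 fun z hz => ?_
    obtain ⟨q, hq1, hq2⟩ := exists_rat_btwn (EReal.coe_lt_coe_iff.1 hz)
    exact (iInf₂_le (q : ℝ) (hgt q hq1)).trans (EReal.coe_le_coe_iff.2 hq2.le)
  · refine le_iInf₂ fun d hd => EReal.coe_le_coe_iff.2 (not_lt.1 fun hdα => ?_)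
    obtain ⟨q, hq1, hq2⟩ := exists_rat_btwn hdα
    exact hlt q hq2 (upperPhiExponents_mono hd hq1.le)

/-! ### Sums of i.i.d. random variables over long blocks -/

section Blocks

variable {Ω : Type*} [MeasurableSpace Ω] {P : Measure Ω} [IsProbabilityMeasure P]

/-- The moment generating function equals $1$ at $0$ and has derivative $\mathbb E T>0$ there, so it
drops below $1$ just to the left. -/
theorem exists_mgf_lt_one {T : Ω → ℝ} (h0 : (0 : ℝ) ∈ interior (integrableExpSet T P))
    (hpos : 0 < ∫ ω, T ω ∂P) :
    ∃ s < 0, Integrable (fun ω => Real.exp (s * T ω)) P ∧ mgf T P s < 1 := by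
  have hder : HasDerivAt (mgf T P) (∫ ω, T ω ∂P) 0 := by
    simpa using hasDerivAt_mgf h0
  have h1 : ∀ᶠ s in 𝓝[<] (0 : ℝ), 0 < slope (mgf T P) 0 s :=
    ((hasDerivAt_iff_tendsto_slope.1 hder).mono_left
      (nhdsWithin_mono 0 fun s hs => ne_of_lt hs)).eventually_const_lt hpos
  have h2 : ∀ᶠ s in 𝓝[<] (0 : ℝ), s ∈ integrableExpSet T P :=
    mem_nhdsWithin_of_mem_nhds (mem_interior_iff_mem_nhds.1 h0)
  obtain ⟨s, ⟨hs1, hs2⟩, hs3⟩ := ((h1.and h2).and self_mem_nhdsWithin).exists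
  have hs3 : s < 0 := hs3
  refine ⟨s, hs3, hs2, ?_⟩
  rw [slope_def_field, mgf_zero, sub_zero] at hs1
  by_contra hcon
  have := div_nonpos_of_nonneg_of_nonpos (sub_nonneg.2 (not_lt.1 hcon)) hs3.le
  linarith

/-- The sums of i.i.d. random variables of positive mean over all blocks that start at most
exponentially late in terms of their length are eventually nonnegative. -/
theorem exists_ae_eventually_sum_nonneg {T : ℕ → Ω → ℝ} (hT : ∀ n, Measurable (T n))
    (hind : iIndepFun T P) (hid : ∀ n, IdentDistrib (T n) (T 0) P P)
    (h0 : (0 : ℝ) ∈ interior (integrableExpSet (T 0) P)) (hpos : 0 < ∫ ω, T 0 ω ∂P) :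
    ∃ L : ℝ, 1 < L ∧ ∀ᵐ ω ∂P, ∀ᶠ k : ℕ in atTop, ∀ m : ℕ, (m : ℝ) ≤ L ^ k →
      0 ≤ ∑ i ∈ Finset.Ico m (m + k), T i ω := by
  obtain ⟨s, hs, hint, hlt⟩ := exists_mgf_lt_one h0 hpos
  set ρ := mgf (T 0) P s with hρ
  have hρ0 : 0 ≤ ρ := mgf_nonneg
  have hintn : ∀ n, Integrable (fun ω => Real.exp (s * T n ω)) P := fun n =>
    ((hid n).comp (u := fun x => Real.exp (s * x)) (by fun_prop)).integrable_iff.2 hint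
  have hblock : ∀ m k : ℕ, P.real {ω | ∑ i ∈ Finset.Ico m (m + k), T i ω ≤ 0} ≤ ρ ^ k := by
    intro m k
    have hi := hind.integrable_exp_mul_sum hT (s := Finset.Ico m (m + k)) (t := s)
      fun i _ => hintn i
    have := measure_le_le_exp_mul_mgf (μ := P) 0 hs.le hi
    rw [hind.mgf_sum hT, Finset.prod_congr rfl
      fun i _ => mgf_congr_of_identDistrib (T i) (T 0) (hid i) s] at this
    simpa [Finset.prod_const, ← hρ] using this
  -- This choice satisfies both `1 < L` and `L * ρ < 1`, so the union bound over `⌊L ^ k⌋₊ + 1`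
  -- starting steps remains summable.
  refine ⟨2 / (1 + ρ), by rw [lt_div_iff₀ (by positivity)]; linarith, ?_⟩
  set L := 2 / (1 + ρ) with hLdef
  have hL0 : 0 < L := by positivity
  have hLρ : L * ρ < 1 := by
    rw [hLdef, div_mul_eq_mul_div, div_lt_one (by positivity)]
    linarith
  let F : ℕ → Set Ω := fun k => ⋃ m ∈ Finset.range (⌊L ^ k⌋₊ + 1),
    {ω | ∑ i ∈ Finset.Ico m (m + k), T i ω ≤ 0}
  have hF : ∀ k, P (F k) ≤ ENNReal.ofReal ((L * ρ) ^ k + ρ ^ k) := by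
    intro k
    have h1 : P.real (F k) ≤ ∑ m ∈ Finset.range (⌊L ^ k⌋₊ + 1), ρ ^ k :=
      (measureReal_biUnion_finset_le _ _).trans (Finset.sum_le_sum fun m _ => hblock m k)
    rw [Finset.sum_const, Finset.card_range, nsmul_eq_mul] at h1
    rw [← ofReal_measureReal (measure_ne_top P _)]
    refine ENNReal.ofReal_le_ofReal (h1.trans ?_)
    have h2 := Nat.floor_le (show 0 ≤ L ^ k by positivity)
    have h3 : 0 ≤ ρ ^ k := by positivity
    rw [mul_pow]
    push_cast
    nlinarith
  have hsum : Summable fun k : ℕ => (L * ρ) ^ k + ρ ^ k :=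
    (summable_geometric_of_lt_one (by positivity) hLρ).add (summable_geometric_of_lt_one hρ0 hlt)
  have hne : ∑' k, P (F k) ≠ ⊤ :=
    ne_top_of_le_ne_top hsum.tsum_ofReal_ne_top (ENNReal.tsum_le_tsum hF)
  filter_upwards [ae_eventually_notMem hne] with ω hω
  filter_upwards [hω] with k hk m hm
  by_contra hcon
  refine hk (Set.mem_biUnion (x := m) ?_ (le_of_lt (not_le.1 hcon)))
  exact Finset.mem_coe.2 (Finset.mem_range.2 (Nat.lt_succ_of_le (Nat.le_floor hm)))

omit [IsProbabilityMeasure P] in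
theorem ae_tendsto_sum_atBot {T : ℕ → Ω → ℝ} (hint : Integrable (T 0) P)
    (hind : iIndepFun T P) (hid : ∀ n, IdentDistrib (T n) (T 0) P P)
    (hneg : ∫ ω, T 0 ω ∂P < 0) :
    ∀ᵐ ω ∂P, Tendsto (fun n : ℕ => ∑ i ∈ Finset.range n, T i ω) atTop atBot := by
  filter_upwards [strong_law_ae_real T hint (fun i j hij => hind.indepFun hij) hid] with ω hω
  have := hω.neg_mul_atTop hneg tendsto_natCast_atTop_atTop
  refine this.congr' ?_
  filter_upwards [eventually_gt_atTop 0] with n hn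
  have : (n : ℝ) ≠ 0 := by positivity
  field_simp

end Blocks

/-! ### The mean of `Y(θ) - θ Z(θ)` -/

theorem measurable_moranY (θ : ℝ) :
    Measurable fun x : ℝ × ℝ × unitInterval => moranY x.1 x.2.1 x.2.2 θ := by
  unfold moranY moranThreshold
  refine Measurable.ite (measurableSet_le ?_ ?_) ?_ ?_ <;> fun_prop

theorem measurable_moranZ (θ : ℝ) :
    Measurable fun x : ℝ × ℝ × unitInterval => moranZ x.1 x.2.1 x.2.2 θ := by
  unfold moranZ moranThreshold
  refine Measurable.ite (measurableSet_le ?_ ?_) ?_ ?_ <;> fun_prop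

theorem measurable_moranX (θ : ℝ) : Measurable (moranX θ) :=
  (measurable_moranY θ).sub ((measurable_moranZ θ).const_mul θ)

/-- Each candidate in the minimum grows by $\theta'-\theta$ times minus the log of a ratio in
$[A,B]$. The mean inherits strict monotonicity and a Lipschitz bound. -/
theorem moranX_le_add {A B : ℝ} {x : ℝ × ℝ × unitInterval} (hA : 0 < A) (ha : A ≤ x.1)
    (hb : A ≤ x.2.1) (haB : x.1 ≤ B) (hbB : x.2.1 ≤ B) (hp : 0 < (x.2.2 : ℝ))
    (hp1 : (x.2.2 : ℝ) < 1) {θ θ' : ℝ} (hθ : θ ≤ θ') :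
    moranX θ x + (θ' - θ) * (-Real.log B) ≤ moranX θ' x ∧
      moranX θ' x ≤ moranX θ x + (θ' - θ) * (-Real.log A) := by
  have ha0 := hA.trans_le ha
  have hb0 := hA.trans_le hb
  rw [moranX_eq_min ha0 hb0 hp hp1, moranX_eq_min ha0 hb0 hp hp1, ← min_add_add_right,
    ← min_add_add_right]
  have h1 := Real.log_le_log hA ha
  have h2 := Real.log_le_log hA hb
  have h3 := Real.log_le_log ha0 haB
  have h4 := Real.log_le_log hb0 hbB
  constructor <;> refine min_le_min ?_ ?_ <;> nlinarith

section Mean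

variable {Ω : Type*} [MeasurableSpace Ω] {P : Measure Ω} [IsProbabilityMeasure P]

omit [IsProbabilityMeasure P] in
-- In `ENNReal` a negative power of `0` is `⊤`, so a finite moment excludes the value `0`.
theorem ae_pos_of_lintegral_rpow_neg {f : Ω → ℝ} (hf : Measurable f) {t : ℝ} (ht : 0 < t)
    (h : ∫⁻ ω, ENNReal.ofReal (f ω) ^ (-t) ∂P < ⊤) : ∀ᵐ ω ∂P, 0 < f ω := by
  filter_upwards [ae_lt_top (by fun_prop) h.ne] with ω hω
  by_contra hcon
  rw [ENNReal.ofReal_of_nonpos (not_lt.1 hcon), ENNReal.zero_rpow_of_neg (by linarith)] at hω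
  exact lt_irrefl _ hω

omit [IsProbabilityMeasure P] in
theorem integrable_rpow_neg {f : Ω → ℝ} (hf : Measurable f) {t : ℝ} (ht : 0 < t)
    (h : ∫⁻ ω, ENNReal.ofReal (f ω) ^ (-t) ∂P < ⊤) : Integrable (fun ω => f ω ^ (-t)) P := by
  have hpos := ae_pos_of_lintegral_rpow_neg hf ht h
  refine ⟨(hf.pow_const (-t)).aestronglyMeasurable, ?_⟩
  rw [hasFiniteIntegral_iff_ofReal (by filter_upwards [hpos] with ω hω; positivity)]
  refine (lintegral_congr_ae ?_).trans_lt h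
  filter_upwards [hpos] with ω hω
  rw [ENNReal.ofReal_rpow_of_pos hω]

/-- A random step of the construction: the ratios lie in the prescribed set, and the weights are
nondegenerate and have a finite negative moment. -/
structure IsMoranStep (P : Measure Ω) (A B t : ℝ) (x : Ω → ℝ × ℝ × unitInterval) : Prop where
  measurable : Measurable x
  pos : 0 < A
  lt_one : B < 1
  moment_pos : 0 < t
  left : ∀ ω, A ≤ (x ω).1
  right : ∀ ω, A ≤ (x ω).2.1
  left_le : ∀ ω, (x ω).1 ≤ B
  right_le : ∀ ω, (x ω).2.1 ≤ B
  weight_pos : ∀ᵐ ω ∂P, 0 < ((x ω).2.2 : ℝ)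
  weight_lt_one : ∀ᵐ ω ∂P, ((x ω).2.2 : ℝ) < 1
  moment : Integrable (fun ω => ((x ω).2.2 : ℝ) ^ (-t)) P
  moment' : Integrable (fun ω => (1 - ((x ω).2.2 : ℝ)) ^ (-t)) P

namespace IsMoranStep

variable {A B t : ℝ} {x : Ω → ℝ × ℝ × unitInterval} (h : IsMoranStep P A B t x)
include h

omit [IsProbabilityMeasure P] in
theorem bound_pos (ω : Ω) : 0 < B := h.pos.trans_le ((h.left ω).trans (h.left_le ω))

theorem log_bound_neg : Real.log B < 0 := by
  obtain ⟨ω⟩ := nonempty_of_isProbabilityMeasure P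
  exact Real.log_neg (h.bound_pos ω) h.lt_one

omit [IsProbabilityMeasure P] in
theorem moranZ_mem (θ : ℝ) (ω : Ω) :
    Real.log A ≤ moranZ (x ω).1 (x ω).2.1 (x ω).2.2 θ ∧
      moranZ (x ω).1 (x ω).2.1 (x ω).2.2 θ ≤ Real.log B := by
  have ha := h.pos.trans_le (h.left ω)
  have hb := h.pos.trans_le (h.right ω)
  unfold moranZ
  split_ifs
  · exact ⟨Real.log_le_log h.pos (h.left ω), Real.log_le_log ha (h.left_le ω)⟩
  · exact ⟨Real.log_le_log h.pos (h.right ω), Real.log_le_log hb (h.right_le ω)⟩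

theorem integrable_moranZ (θ : ℝ) :
    Integrable (fun ω => moranZ (x ω).1 (x ω).2.1 (x ω).2.2 θ) P :=
  Integrable.of_mem_Icc (Real.log A) (Real.log B)
    ((measurable_moranZ θ).comp h.measurable).aemeasurable
    (ae_of_all _ fun ω => h.moranZ_mem θ ω)

omit [IsProbabilityMeasure P] in
/-- `exp (s |Y(θ)|)` is bounded by the sum of the negative moments. -/
theorem exp_neg_moranY_le {s : ℝ} (hs : s ≤ t) (θ : ℝ) : ∀ᵐ ω ∂P,
    moranY (x ω).1 (x ω).2.1 (x ω).2.2 θ ≤ 0 ∧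
    Real.exp (-s * moranY (x ω).1 (x ω).2.1 (x ω).2.2 θ) ≤
      ((x ω).2.2 : ℝ) ^ (-t) + (1 - ((x ω).2.2 : ℝ)) ^ (-t) := by
  filter_upwards [h.weight_pos, h.weight_lt_one] with ω h0 h1
  have key : ∀ q : ℝ, 0 < q → q < 1 → Real.log q ≤ 0 ∧ Real.exp (-s * Real.log q) ≤ q ^ (-t) := by
    intro q hq hq1
    have hl := Real.log_neg hq hq1
    refine ⟨hl.le, ?_⟩
    rw [Real.rpow_def_of_pos hq]
    exact Real.exp_le_exp.2 (by nlinarith)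
  have k1 := key _ h0 h1
  have k2 := key (1 - ((x ω).2.2 : ℝ)) (by linarith) (by linarith)
  have e1 : 0 ≤ ((x ω).2.2 : ℝ) ^ (-t) := by positivity
  have e2 : 0 ≤ (1 - ((x ω).2.2 : ℝ)) ^ (-t) := Real.rpow_nonneg (by linarith) _
  unfold moranY
  split_ifs
  · exact ⟨k1.1, by linarith [k1.2]⟩
  · exact ⟨k2.1, by linarith [k2.2]⟩

omit [IsProbabilityMeasure P] in
theorem integrable_moranY (θ : ℝ) :
    Integrable (fun ω => moranY (x ω).1 (x ω).2.1 (x ω).2.2 θ) P := by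
  refine ((h.moment.add h.moment').div_const t).mono'
    ((measurable_moranY θ).comp h.measurable).aestronglyMeasurable ?_
  filter_upwards [h.exp_neg_moranY_le le_rfl θ] with ω hω
  have ht := h.moment_pos
  rw [Real.norm_eq_abs, abs_of_nonpos hω.1, le_div_iff₀ ht]
  -- Integrability follows from $t|Y|\le e^{t|Y|}$.
  have := Real.add_one_le_exp (-t * moranY (x ω).1 (x ω).2.1 (x ω).2.2 θ)
  simp only [Pi.add_apply]
  linarith [hω.2]

theorem integrable_moranX (θ : ℝ) : Integrable (fun ω => moranX θ (x ω)) P :=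
  (h.integrable_moranY θ).sub ((h.integrable_moranZ θ).const_mul θ)

theorem integral_moranX (θ : ℝ) : ∫ ω, moranX θ (x ω) ∂P =
    ∫ ω, moranY (x ω).1 (x ω).2.1 (x ω).2.2 θ ∂P -
      θ * ∫ ω, moranZ (x ω).1 (x ω).2.1 (x ω).2.2 θ ∂P := by
  unfold moranX
  rw [integral_sub (h.integrable_moranY θ) ((h.integrable_moranZ θ).const_mul θ),
    integral_const_mul]

theorem integral_moranZ_neg (θ : ℝ) : ∫ ω, moranZ (x ω).1 (x ω).2.1 (x ω).2.2 θ ∂P < 0 := by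
  have := integral_mono (h.integrable_moranZ θ) (integrable_const (Real.log B))
    fun ω => (h.moranZ_mem θ ω).2
  simp only [integral_const, probReal_univ, one_smul] at this
  exact this.trans_lt h.log_bound_neg

theorem integral_moranX_bounds {θ θ' : ℝ} (hθ : θ ≤ θ') :
    ∫ ω, moranX θ (x ω) ∂P + (θ' - θ) * (-Real.log B) ≤ ∫ ω, moranX θ' (x ω) ∂P ∧
      ∫ ω, moranX θ' (x ω) ∂P ≤ ∫ ω, moranX θ (x ω) ∂P + (θ' - θ) * (-Real.log A) := by
  have key : ∀ᵐ ω ∂P, moranX θ (x ω) + (θ' - θ) * (-Real.log B) ≤ moranX θ' (x ω) ∧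
      moranX θ' (x ω) ≤ moranX θ (x ω) + (θ' - θ) * (-Real.log A) := by
    filter_upwards [h.weight_pos, h.weight_lt_one] with ω h0 h1
    exact moranX_le_add h.pos (h.left ω) (h.right ω) (h.left_le ω) (h.right_le ω) h0 h1 hθ
  have hX := h.integrable_moranX θ
  have hX' := h.integrable_moranX θ'
  constructor
  · have := integral_mono_ae (hX.add (integrable_const _)) hX' (key.mono fun ω hω => hω.1)
    simpa [integral_add hX (integrable_const _)] using this
  · have := integral_mono_ae hX' (hX.add (integrable_const _)) (key.mono fun ω hω => hω.2)
    simpa [integral_add hX (integrable_const _)] using this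

theorem strictMono_integral_moranX : StrictMono fun θ => ∫ ω, moranX θ (x ω) ∂P := by
  intro θ θ' hθ
  have h1 := (h.integral_moranX_bounds hθ.le).1
  have h2 := h.log_bound_neg
  simp only
  nlinarith

theorem continuous_integral_moranX : Continuous fun θ => ∫ ω, moranX θ (x ω) ∂P := by
  have hmono := h.strictMono_integral_moranX.monotone
  refine (LipschitzWith.of_le_add_mul (-Real.log A).toNNReal fun θ θ' => ?_).continuous
  have hA : -Real.log A ≤ ((-Real.log A).toNNReal : ℝ) := Real.le_coe_toNNReal _
  rcases le_total θ θ' with hθ | hθ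
  · have := hmono hθ
    simp only at this
    have : 0 ≤ ((-Real.log A).toNNReal : ℝ) * dist θ θ' := by positivity
    linarith
  · have := (h.integral_moranX_bounds hθ).2
    rw [Real.dist_eq, abs_of_nonneg (by linarith)]
    nlinarith

theorem exists_integral_moranX_eq_zero : ∃ α : ℝ, 0 ≤ α ∧ ∫ ω, moranX α (x ω) ∂P = 0 := by
  set F : ℝ → ℝ := fun θ => ∫ ω, moranX θ (x ω) ∂P with hF
  have hB := h.log_bound_neg
  have h0 : F 0 ≤ 0 := by
    rw [hF]
    refine integral_nonpos_of_ae ?_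
    filter_upwards [h.exp_neg_moranY_le le_rfl 0] with ω hω
    simpa [moranX] using hω.1
  -- Here the lower bound $F(0)+\theta(-\log B)$ for $F(\theta)$ reaches $0$.
  set θ := F 0 / Real.log B with hθ
  have hθ0 : 0 ≤ θ := div_nonneg_of_nonpos h0 hB.le
  have h1 : 0 ≤ F θ := by
    have := (h.integral_moranX_bounds hθ0).1
    have e : θ * Real.log B = F 0 := div_mul_cancel₀ _ hB.ne
    have e' : F 0 = ∫ ω, moranX 0 (x ω) ∂P := rfl
    have e'' : F θ = ∫ ω, moranX θ (x ω) ∂P := rfl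
    linarith
  obtain ⟨α, hα, hα0⟩ := intermediate_value_Icc hθ0 h.continuous_integral_moranX.continuousOn
    (show (0 : ℝ) ∈ Set.Icc (F 0) (F θ) from ⟨h0, h1⟩)
  exact ⟨α, hα.1, hα0⟩

theorem crossesDiagonalAt {α : ℝ} (hα : ∫ ω, moranX α (x ω) ∂P = 0) :
    CrossesDiagonalAt (moranG P (fun ω => (x ω).1) (fun ω => (x ω).2.1) fun ω => (x ω).2.2) α := by
  have hmono := h.strictMono_integral_moranX
  constructor
  · intro ψ _ hψ
    have := hmono hψ
    simp only [hα, h.integral_moranX ψ] at this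
    rw [moranG, div_lt_iff_of_neg (h.integral_moranZ_neg ψ)]
    linarith
  · intro ψ _ hψ
    have := hmono hψ
    simp only [hα, h.integral_moranX ψ] at this
    rw [moranG, le_div_iff_of_neg (h.integral_moranZ_neg ψ)]
    linarith

/-- For $|s|\le t$ the moments of the weights dominate $e^{|s||Y|}$, and $Z$ is bounded. This is the
input to the Chernoff bound. -/
theorem zero_mem_interior_integrableExpSet {θ : ℝ} (hθ : 0 ≤ θ) :
    (0 : ℝ) ∈ interior (integrableExpSet (fun ω => moranX θ (x ω)) P) := by
  rw [mem_interior_iff_mem_nhds]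
  filter_upwards [Icc_mem_nhds (neg_lt_zero.2 h.moment_pos) h.moment_pos] with s hs
  refine (((h.moment.add h.moment').mul_const (Real.exp (|s| * (θ * |Real.log A|))))).mono'
    (by have := (measurable_moranX θ).comp h.measurable
        exact (Real.measurable_exp.comp (this.const_mul s)).aestronglyMeasurable) ?_
  filter_upwards [h.exp_neg_moranY_le (abs_le.2 hs) θ] with ω hω
  have hZ := h.moranZ_mem θ ω
  have hB := h.log_bound_neg
  have hZA : |moranZ (x ω).1 (x ω).2.1 (x ω).2.2 θ| ≤ |Real.log A| := by
    rw [abs_of_nonpos (by linarith), abs_of_nonpos (by linarith)]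
    linarith
  rw [Real.norm_eq_abs, Real.abs_exp]
  calc Real.exp (s * moranX θ (x ω))
      ≤ Real.exp (-|s| * moranY (x ω).1 (x ω).2.1 (x ω).2.2 θ + |s| * (θ * |Real.log A|)) := by
        refine Real.exp_le_exp.2 ((le_abs_self _).trans ?_)
        rw [abs_mul, moranX]
        have e1 := abs_sub (moranY (x ω).1 (x ω).2.1 (x ω).2.2 θ)
          (θ * moranZ (x ω).1 (x ω).2.1 (x ω).2.2 θ)
        rw [abs_of_nonpos hω.1, abs_mul, abs_of_nonneg hθ] at e1
        have e2 := mul_le_mul_of_nonneg_left hZA hθ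
        have e3 := mul_le_mul_of_nonneg_left (e1.trans (add_le_add_right e2 _)) (abs_nonneg s)
        linarith
    _ ≤ _ := by
        rw [Real.exp_add]
        exact mul_le_mul_of_nonneg_right hω.2 (Real.exp_pos _).le

end IsMoranStep

end Mean

/-- Between two nonnegative crossing points the midpoint is contradictory. A negative one would
force `G 0 < 0`, since the condition only tests `ψ ≥ 0`. -/
theorem CrossesDiagonalAt.unique {G : ℝ → ℝ} {α β : ℝ} (hα : CrossesDiagonalAt G α)
    (hβ : CrossesDiagonalAt G β) (hα0 : 0 ≤ α) (hG : 0 ≤ G 0) : α = β := by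
  rcases lt_trichotomy α β with hlt | rfl | hlt
  · have h1 := hα.1 ((α + β) / 2) (by linarith) (by linarith)
    have h2 := hβ.2 ((α + β) / 2) (by linarith) (by linarith)
    linarith
  · rfl
  · rcases lt_or_ge β 0 with hβ0 | hβ0
    · have := hβ.1 0 le_rfl hβ0
      linarith
    · have h1 := hβ.1 ((α + β) / 2) (by linarith) (by linarith)
      have h2 := hα.2 ((α + β) / 2) (by linarith) (by linarith)
      linarith

/-! ### The almost sure value of the upper `Φ`-dimension -/

theorem mainTheorem3 {Ω : Type*} [MeasurableSpace Ω] (P : Measure Ω) [IsProbabilityMeasure P]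
    (A B : ℝ) (hA : 0 < A) (hAB : A < B) (hB : B < 1)
    (a b : ℕ → Ω → ℝ) (p : ℕ → Ω → unitInterval)
    (ha : ∀ n, Measurable (a n)) (hb : ∀ n, Measurable (b n)) (hp : ∀ n, Measurable (p n))
    -- the values of `(a n, b n)` lie in the prescribed set
    (hab : ∀ n ω, A ≤ min (a n ω) (b n ω) ∧ a n ω + b n ω ≤ B)
    -- the triples `(a n, b n, p n)` are independent and identically distributed,
    -- and `p n` is independent of `(a n, b n)`
    (hindep : iIndepFun (fun n ω => (a n ω, b n ω, p n ω)) P)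
    (hident : ∀ n, IdentDistrib (fun ω => (a n ω, b n ω, p n ω))
      (fun ω => (a 0 ω, b 0 ω, p 0 ω)) P P)
    (hindep' : ∀ n, IndepFun (fun ω => (a n ω, b n ω)) (p n) P)
    -- `𝔼 p ^ (-t)` and `𝔼 (1 - p) ^ (-t)` are finite for some `t > 0`
    (hmoment : ∃ t : ℝ, 0 < t ∧ ∫⁻ ω, ENNReal.ofReal (p 0 ω : ℝ) ^ (-t) ∂P < ⊤)
    (hmoment' : ∃ t : ℝ, 0 < t ∧ ∫⁻ ω, ENNReal.ofReal (1 - (p 0 ω : ℝ)) ^ (-t) ∂P < ⊤)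
    (Φ : ℝ → ℝ) (hΦ : IsLargeDimensionFunction Φ) :
    (∀ α : ℝ,
      (∀ᵐ ω ∂P, upperPhiDim Φ
          (moranMeasure (fun n => a n ω) (fun n => b n ω) (fun n => p n ω)) = (α : EReal)) ↔
        CrossesDiagonalAt (moranG P (a 0) (b 0) (p 0)) α) ∧
    ∃ α : ℝ, 0 ≤ α ∧
      (∀ᵐ ω ∂P, upperPhiDim Φ
          (moranMeasure (fun n => a n ω) (fun n => b n ω) (fun n => p n ω)) = (α : EReal)) ∧
      CrossesDiagonalAt (moranG P (a 0) (b 0) (p 0)) α := by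
  have hstep : ∃ t, IsMoranStep P A B t fun ω => (a 0 ω, b 0 ω, p 0 ω) := by
    obtain ⟨t₁, ht₁, hm₁⟩ := hmoment
    obtain ⟨t₂, ht₂, hm₂⟩ := hmoment'
    have hp0 : Measurable fun ω => (p 0 ω : ℝ) := measurable_subtype_coe.comp (hp 0)
    have hp1 : Measurable fun ω => 1 - (p 0 ω : ℝ) := hp0.const_sub 1
    have hpos := ae_pos_of_lintegral_rpow_neg hp0 ht₁ hm₁
    have hpos' := ae_pos_of_lintegral_rpow_neg hp1 ht₂ hm₂
    have hmono : ∀ {f : Ω → ℝ} {s t : ℝ}, Measurable f → (∀ᵐ ω ∂P, 0 < f ω) → (∀ ω, f ω ≤ 1) →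
        t ≤ s → Integrable (fun ω => f ω ^ (-s)) P → Integrable (fun ω => f ω ^ (-t)) P := by
      intro f s t hf hf0 hf1 hts hint
      refine hint.mono' (hf.pow_const _).aestronglyMeasurable ?_
      filter_upwards [hf0] with ω hω
      rw [Real.norm_of_nonneg (by positivity)]
      exact Real.rpow_le_rpow_of_exponent_ge hω (hf1 ω) (by linarith)
    -- Both weights are at most $1$, so lowering the exponent preserves finiteness of the moments.
    exact ⟨min t₁ t₂, {
      measurable := (ha 0).prodMk ((hb 0).prodMk (hp 0))
      pos := hA
      lt_one := hB
      moment_pos := lt_min ht₁ ht₂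
      left := fun ω => (le_min_iff.1 (hab 0 ω).1).1
      right := fun ω => (le_min_iff.1 (hab 0 ω).1).2
      left_le := fun ω => by linarith [(le_min_iff.1 (hab 0 ω).1).2, (hab 0 ω).2]
      right_le := fun ω => by linarith [(le_min_iff.1 (hab 0 ω).1).1, (hab 0 ω).2]
      weight_pos := hpos
      weight_lt_one := hpos'.mono fun ω hω => by simpa using hω
      moment := hmono hp0 hpos (fun ω => (p 0 ω).2.2) (min_le_left _ _)
        (integrable_rpow_neg hp0 ht₁ hm₁)
      moment' := hmono hp1 hpos' (fun ω => by linarith [(p 0 ω).2.1]) (min_le_right _ _)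
        (integrable_rpow_neg hp1 ht₂ hm₂) }⟩
  obtain ⟨t, hstep⟩ := hstep
  obtain ⟨α, hα0, hα⟩ := hstep.exists_integral_moranX_eq_zero
  have hmono := hstep.strictMono_integral_moranX
  have hcross := hstep.crossesDiagonalAt hα
  have hweights : ∀ᵐ ω ∂P, ∀ n, 0 < (p n ω : ℝ) ∧ (p n ω : ℝ) < 1 := by
    rw [ae_all_iff]
    intro n
    have hmeas : Measurable fun x : ℝ × ℝ × unitInterval => (x.2.2 : ℝ) := by fun_prop
    exact (hident n).symm.ae_snd (p := fun x => 0 < (x.2.2 : ℝ) ∧ (x.2.2 : ℝ) < 1)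
      ((measurableSet_lt measurable_const hmeas).inter (measurableSet_lt hmeas measurable_const))
      (hstep.weight_pos.and hstep.weight_lt_one)
  have hXind : ∀ θ, iIndepFun (fun n ω => moranX θ (a n ω, b n ω, p n ω)) P := fun θ =>
    hindep.comp (fun _ => moranX θ) fun _ => measurable_moranX θ
  have hXid : ∀ θ n, IdentDistrib (fun ω => moranX θ (a n ω, b n ω, p n ω))
      (fun ω => moranX θ (a 0 ω, b 0 ω, p 0 ω)) P P := fun θ n =>
    (hident n).comp (measurable_moranX θ)
  have hupper : ∀ q : ℚ, α < (q : ℝ) → ∃ L : ℝ, 1 < L ∧ ∀ᵐ ω ∂P, ∀ᶠ k : ℕ in atTop,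
      ∀ m : ℕ, (m : ℝ) ≤ L ^ k →
        0 ≤ ∑ i ∈ Finset.Ico m (m + k), moranX q (a i ω, b i ω, p i ω) := fun q hq =>
    exists_ae_eventually_sum_nonneg
      (fun n => (measurable_moranX q).comp ((ha n).prodMk ((hb n).prodMk (hp n))))
      (hXind q) (hXid q) (hstep.zero_mem_interior_integrableExpSet (hα0.trans hq.le))
      (hα.symm.trans_lt (hmono hq))
  choose! L hL1 hL using hupper
  have hlower : ∀ᵐ ω ∂P, ∀ q : ℚ, (q : ℝ) < α → Tendsto (fun n : ℕ =>
      ∑ i ∈ Finset.range n, moranX q (a i ω, b i ω, p i ω)) atTop atBot := by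
    rw [ae_all_iff]
    intro q
    rw [eventually_imp_distrib_left]
    exact fun hq => ae_tendsto_sum_atBot (hstep.integrable_moranX q) (hXind q) (hXid q)
      ((hmono hq).trans_eq hα)
  have hupper : ∀ᵐ ω ∂P, ∀ q : ℚ, α < (q : ℝ) → ∀ᶠ k : ℕ in atTop, ∀ m : ℕ,
      (m : ℝ) ≤ L q ^ k → 0 ≤ ∑ i ∈ Finset.Ico m (m + k), moranX q (a i ω, b i ω, p i ω) := by
    rw [ae_all_iff]
    intro q
    rw [eventually_imp_distrib_left]
    exact hL q
  have hdim : ∀ᵐ ω ∂P, upperPhiDim Φ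
      (moranMeasure (fun n => a n ω) (fun n => b n ω) (fun n => p n ω)) = (α : EReal) := by
    filter_upwards [hweights, hlower, hupper] with ω hω hlo hup
    have hbd : IsMoranBounded A B (fun n => a n ω) (fun n => b n ω) :=
      ⟨hA, hB, fun n => (le_min_iff.1 (hab n ω).1).1, fun n => (le_min_iff.1 (hab n ω).1).2,
        fun n => (hab n ω).2⟩
    exact upperPhiDim_eq_of_forall_rat
      (fun q hq => hbd.notMem_upperPhiExponents (fun n => (hω n).1) (fun n => (hω n).2) hΦ.1
        (hlo q hq))
      (fun q hq => hbd.mem_upperPhiExponents (fun n => (hω n).1) (fun n => (hω n).2) hΦ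
        (hα0.trans hq.le) (hL1 q hq) (hup q hq))
  have hG0 : 0 ≤ moranG P (a 0) (b 0) (p 0) 0 := by
    refine div_nonneg_of_nonpos (integral_nonpos_of_ae ?_) (hstep.integral_moranZ_neg 0).le
    exact (hstep.exp_neg_moranY_le le_rfl 0).mono fun ω hω => hω.1
  refine ⟨fun β => ⟨fun hβ => ?_, fun hβ => ?_⟩, α, hα0, hdim, hcross⟩
  -- Two almost sure values agree at a common sample point.
  · obtain ⟨ω, h1, h2⟩ := (hβ.and hdim).exists
    rw [← EReal.coe_eq_coe_iff.1 (h2.symm.trans h1)]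
    exact hcross
  · rw [← hcross.unique hβ hα0 hG0]
    exact hdim
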